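/- Let $G$ be a finite simple graph. Given a set $L$ of vertices (the leaks) and a set of blue vertices (all other vertices being white), a blue vertex $u\notin L$ may force a white vertex $v$, that is, turn it blue, if $v$ is the only white neighbour of $u$. A set $B\subseteq V(G)$ is a $1$-leaky forcing set if, for every choice of a set $L$ consisting of one vertex, starting with exactly the vertices of $B$ blue and applying this rule repeatedly can turn every vertex of $G$ blue. The $1$-leaky forcing number $Z_{(1)}(G)$ is the smallest size of a $1$-leaky forcing set of $G$. Let $P_n$ denote the path on $n$ vertices and $\square$ the Cartesian product of graphs. **Theorem.** If $1 \le n \le m$, then $Z_{(1)}(P_n \,\square\, P_m) \le \min\{2n, m\}$. -/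

import Mathlib

namespace SimpleGraph

section LeakyForcing

variable {V : Type*}

/-- With blue set `S` and set of leaks `L`, the force `u → v` is valid: `u` is blue, `u` is not a
leak, and `v` is the only white neighbour of `u`. -/
def IsValidForce (G : SimpleGraph V) (L S : Finset V) (u v : V) : Prop :=
  u ∈ S ∧ u ∉ L ∧ v ∉ S ∧ G.Adj u v ∧ ∀ w, G.Adj u w → w ∉ S → w = v

/-- One application of the colour change rule: some vertex performs a valid force, and the blue set
`S` becomes `S'`. -/
def ForceStep [DecidableEq V] (G : SimpleGraph V) (L S S' : Finset V) : Prop :=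
  ∃ u v, G.IsValidForce L S u v ∧ S' = insert v S

/-- `B` is an `ℓ`-leaky forcing set: however `ℓ` vertices are chosen to be leaks, finitely many
applications of the colour change rule, starting from the blue set `B`, turn every vertex blue. -/
def IsLeakyForcingSet [Fintype V] [DecidableEq V] (G : SimpleGraph V) (ℓ : ℕ) (B : Finset V) :
    Prop :=
  ∀ L : Finset V, L.card = ℓ → Relation.ReflTransGen (G.ForceStep L) B Finset.univ

/-- The `ℓ`-leaky forcing number: the least size of an `ℓ`-leaky forcing set. -/
noncomputable def leakyForcingNumber [Fintype V] [DecidableEq V] (G : SimpleGraph V) (ℓ : ℕ) : ℕ :=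
  sInf {k | ∃ B : Finset V, G.IsLeakyForcingSet ℓ B ∧ B.card = k}

/-- The minimum in the definition of the leaky forcing number is over a nonempty set, so that it is
attained. -/
theorem exists_isLeakyForcingSet_card_eq [Fintype V] [DecidableEq V] (G : SimpleGraph V) (ℓ : ℕ) :
    ∃ B : Finset V, G.IsLeakyForcingSet ℓ B ∧ B.card = G.leakyForcingNumber ℓ :=
  Nat.sInf_mem (s := {k | ∃ B : Finset V, G.IsLeakyForcingSet ℓ B ∧ B.card = k})
    ⟨_, Finset.univ, fun _ _ => Relation.ReflTransGen.refl, rfl⟩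

end LeakyForcing

end SimpleGraph

namespace SimpleGraph

section Stalled

variable {V : Type*} {G : SimpleGraph V}

/-- The set `S` is stalled for the leak `x`: no vertex of `S` other than `x` has exactly one
neighbour outside `S`. -/
def IsStalled (G : SimpleGraph V) (x : V) (S : Finset V) : Prop :=
  ∀ u v, u ∈ S → u ≠ x → G.Adj u v → (∀ w, G.Adj u w → w ≠ v → w ∈ S) → v ∈ S

/-- It suffices to show that every stalled set containing `B` is the whole vertex set. -/
theorem isLeakyForcingSet_one_of_isStalled [Fintype V] [DecidableEq V] {B : Finset V}
    (h : ∀ x S, B ⊆ S → G.IsStalled x S → S = Finset.univ) : G.IsLeakyForcingSet 1 B := by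
  intro L hL
  obtain ⟨x, rfl⟩ := Finset.card_eq_one.mp hL
  suffices H : ∀ d (S : Finset V), B ⊆ S → Sᶜ.card = d →
      Relation.ReflTransGen (G.ForceStep {x}) S Finset.univ from H _ B subset_rfl rfl
  intro d
  induction d with
  | zero =>
    intro S _ hd
    rw [Finset.card_eq_zero, Finset.compl_eq_empty_iff] at hd
    rw [hd]
  | succ d ih =>
    intro S hBS hd
    have hS : ¬ G.IsStalled x S := by
      intro hst
      simp [h x S hBS hst] at hd
    simp only [IsStalled, not_forall] at hS
    obtain ⟨u, v, hu, hux, huv, hw, hv⟩ := hS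
    refine Relation.ReflTransGen.head (b := insert v S) ⟨u, v, ⟨hu, by simpa using hux, hv, huv,
      fun w hadj hwS => by_contra fun hne => hwS (hw w hadj hne)⟩, rfl⟩
      (ih _ (hBS.trans (Finset.subset_insert _ _)) ?_)
    rw [Finset.compl_insert, Finset.card_erase_of_mem (by simpa using hv), hd]
    rfl

theorem leakyForcingNumber_le_card [Fintype V] [DecidableEq V] {ℓ : ℕ} {B : Finset V}
    (hB : G.IsLeakyForcingSet ℓ B) : G.leakyForcingNumber ℓ ≤ B.card :=
  Nat.sInf_le ⟨B, hB, rfl⟩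

/-- The forces `F` form a zero forcing process (without leaks) that starts from the zeros of `r`,
in which the vertices turn blue in the order of their rank `r`. -/
structure IsForcingSchedule (G : SimpleGraph V) (r : V → ℕ) (F : V → V → Prop) : Prop where
  exists_force : ∀ v, r v ≠ 0 → ∃ u, F u v
  unique : ∀ u u' v, F u v → F u' v → u = u'
  adj : ∀ u v, F u v → G.Adj u v
  rank_lt : ∀ u v, F u v → r u < r v
  rank_lt_of_adj : ∀ u v, F u v → ∀ w, G.Adj u w → w ≠ v → r w < r v

namespace IsForcingSchedule

variable {r : V → ℕ} {F : V → V → Prop} {x : V} {S : Finset V}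

theorem mem_of_rank_le (h : G.IsForcingSchedule r F) (hS : G.IsStalled x S)
    (h0 : ∀ v, r v = 0 → v ∈ S) {N : ℕ} (hN : ∀ v, r v ≤ N → ¬ F x v) :
    ∀ v, r v ≤ N → v ∈ S := by
  suffices H : ∀ d v, r v = d → r v ≤ N → v ∈ S from fun v => H _ v rfl
  intro d
  induction d using Nat.strong_induction_on with
  | _ d ih =>
    rintro v rfl hv
    by_cases hv0 : r v = 0
    · exact h0 v hv0
    · obtain ⟨u, hu⟩ := h.exists_force v hv0
      have hlt := h.rank_lt u v hu
      refine hS u v (ih _ hlt u rfl (by omega)) ?_ (h.adj u v hu) fun w hw hne => ?_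
      · rintro rfl
        exact hN v hv hu
      · have := h.rank_lt_of_adj u v hu w hw hne
        exact ih _ this w rfl (by omega)

theorem eq_univ_of_leak_idle [Fintype V] (h : G.IsForcingSchedule r F) (hS : G.IsStalled x S)
    (h0 : ∀ v, r v = 0 → v ∈ S) (hx : ∀ v, ¬ F x v) : S = Finset.univ :=
  Finset.eq_univ_iff_forall.mpr fun v =>
    h.mem_of_rank_le hS h0 (N := r v) (fun v _ => hx v) v le_rfl

/-- If a stalled set contains the initial vertices of a forcing process, as well as the vertices
that perform no force, then it is everything: the part of the process that the leak prevents is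
carried out in the reverse direction. -/
theorem eq_univ_of_terminal_mem [Fintype V] (h : G.IsForcingSchedule r F)
    (hS : G.IsStalled x S) (h0 : ∀ v, r v = 0 → v ∈ S)
    (hT : ∀ u, (∀ v, ¬ F u v) → u ∈ S) : S = Finset.univ := by
  by_cases hx : ∀ v, ¬ F x v
  · exact h.eq_univ_of_leak_idle hS h0 hx
  push Not at hx
  obtain ⟨y, hy⟩ := hx
  have hxy := h.rank_lt x y hy
  have early : ∀ v, r v < r y → v ∈ S := by
    intro v hv
    refine h.mem_of_rank_le hS h0 (N := r y - 1) (fun v' hv' hF => ?_) v (by omega)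
    by_cases hne : y = v'
    · subst hne
      omega
    · have := h.rank_lt_of_adj x v' hF y (h.adj x y hy) hne
      omega
  have late : ∀ d u v, Finset.univ.sup r - r v = d → F u v → r y ≤ r v → u ∈ S := by
    intro d
    induction d using Nat.strong_induction_on with
    | _ d ih =>
      rintro u v rfl huv hyv
      have hlt := h.rank_lt u v huv
      have step : ∀ w w', F w w' → r v < r w' → w ∈ S := fun w w' hw hlt' => by
        have : r w' ≤ Finset.univ.sup r := Finset.le_sup (Finset.mem_univ w')
        exact ih _ (by omega) w w' rfl hw (by omega)
      by_cases hu : r u < r y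
      · exact early u hu
      refine hS v u ?_ ?_ (h.adj u v huv).symm fun w hw hne => ?_
      · by_cases hv : ∀ v', ¬ F v v'
        · exact hT v hv
        · push Not at hv
          obtain ⟨v', hv'⟩ := hv
          exact step v v' hv' (h.rank_lt v v' hv')
      · rintro rfl
        omega
      · by_cases hw' : ∀ w', ¬ F w w'
        · exact hT w hw'
        · push Not at hw'
          obtain ⟨w', hw'⟩ := hw'
          refine step w w' hw' (h.rank_lt_of_adj w w' hw' v hw.symm ?_)
          rintro rfl
          exact hne (h.unique _ _ _ hw' huv)
  refine Finset.eq_univ_iff_forall.mpr fun v => ?_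
  by_cases hv : r v < r y
  · exact early v hv
  by_cases hv' : ∀ v', ¬ F v v'
  · exact hT v hv'
  · push Not at hv'
    obtain ⟨v', hv'⟩ := hv'
    have := h.rank_lt v v' hv'
    exact late _ v v' rfl hv' (by omega)

end IsForcingSchedule

end Stalled

section Grid

variable {n m : ℕ}

theorem boxProd_pathGraph_adj (u v : Fin n × Fin m) :
    (pathGraph n □ pathGraph m).Adj u v ↔
      ((u.1.val + 1 = v.1.val ∨ v.1.val + 1 = u.1.val) ∧ u.2.val = v.2.val) ∨
      ((u.2.val + 1 = v.2.val ∨ v.2.val + 1 = u.2.val) ∧ u.1.val = v.1.val) := by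
  simp only [boxProd_adj, pathGraph_adj, Fin.ext_iff]

/-- The process that turns a grid blue column by column. -/
theorem isForcingSchedule_columns :
    (pathGraph n □ pathGraph m).IsForcingSchedule (fun v => v.2.val)
      (fun u v => u.1 = v.1 ∧ u.2.val + 1 = v.2.val) where
  exists_force := by
    rintro ⟨i, j, hj⟩ h
    simp only [ne_eq] at h
    exact ⟨(i, ⟨j - 1, by omega⟩), rfl, by simp only; omega⟩
  unique := by
    rintro ⟨i, j⟩ ⟨i', j'⟩ ⟨a, b⟩ ⟨h1, h2⟩ ⟨h3, h4⟩
    simp only [Prod.mk.injEq, Fin.ext_iff] at *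
    omega
  adj := by
    rintro ⟨i, j⟩ ⟨a, b⟩ ⟨h1, h2⟩
    simp only [boxProd_pathGraph_adj, Fin.ext_iff] at *
    omega
  rank_lt := by
    rintro ⟨i, j⟩ ⟨a, b⟩ ⟨h1, h2⟩
    simp only at *
    omega
  rank_lt_of_adj := by
    rintro ⟨i, j⟩ ⟨a, b⟩ ⟨h1, h2⟩ ⟨k, l⟩ hw hne
    simp only [boxProd_pathGraph_adj, ne_eq, Prod.mk.injEq, Fin.ext_iff] at *
    omega

/-- The first and the last column together form a `1`-leaky forcing set. -/
theorem leakyForcingNumber_one_grid_le_two_mul :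
    (pathGraph n □ pathGraph m).leakyForcingNumber 1 ≤ 2 * n := by
  rcases Nat.eq_zero_or_pos m with rfl | hm
  · refine (leakyForcingNumber_le_card (B := Finset.univ)
      fun _ _ => Relation.ReflTransGen.refl).trans ?_
    simp
  let B : Finset (Fin n × Fin m) :=
    Finset.univ ×ˢ {⟨0, hm⟩, ⟨m - 1, by omega⟩}
  have hB : (pathGraph n □ pathGraph m).IsLeakyForcingSet 1 B := by
    refine isLeakyForcingSet_one_of_isStalled fun x S hBS hS => ?_
    refine isForcingSchedule_columns.eq_univ_of_terminal_mem hS (fun v hv => hBS ?_)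
      fun u hu => hBS ?_
    · simp only [B, Finset.mem_product, Finset.mem_univ, Finset.mem_insert, Finset.mem_singleton,
        Fin.ext_iff, true_and]
      exact Or.inl hv
    · simp only [B, Finset.mem_product, Finset.mem_univ, Finset.mem_insert, Finset.mem_singleton,
        Fin.ext_iff, true_and]
      by_contra hne
      exact hu (u.1, ⟨u.2.val + 1, by omega⟩) ⟨rfl, rfl⟩
  refine (leakyForcingNumber_le_card hB).trans ?_
  rw [Finset.card_product, Finset.card_univ, Fintype.card_fin, mul_comm]
  exact Nat.mul_le_mul_right _ Finset.card_le_two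

/-- The rank of the cell `(i, j)` of an `n × m` grid in the clockwise sweep along the concentric
rings of the grid. The zeros are the first two cells of every ring and, in the middle row
`(n - 1) / 2`, all the cells of the innermost ring. The top, right, bottom and left sides of the
rings are swept in this order. -/
def spiralRank (n m i j : ℕ) : ℕ :=
  if i < (n - 1) / 2 ∧ i + 2 ≤ j ∧ i + j < m then j
  else if m ≤ i + j ∧ i + m ≤ n + j then m + i
  else if (n - 1) / 2 < i ∧ n ≤ i + j + 1 ∧ n + j < i + m then 3 * m - j
  else if j < i ∧ i + j + 1 < n then 4 * m - i
  else 0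

/-- In the clockwise sweep along the rings, the cell `(i, j)` forces the cell `(a, b)`. -/
def SpiralForce (n m i j a b : ℕ) : Prop :=
  (a < (n - 1) / 2 ∧ a + 2 ≤ b ∧ a + b < m ∧ i = a ∧ j + 1 = b) ∨
  (m ≤ a + b ∧ a + m ≤ n + b ∧ i + 1 = a ∧ j = b) ∨
  ((n - 1) / 2 < a ∧ n ≤ a + b + 1 ∧ n + b < a + m ∧ i = a ∧ j = b + 1) ∨
  (b < a ∧ a + b + 1 < n ∧ i = a + 1 ∧ j = b)

set_option maxHeartbeats 2000000 in
theorem isForcingSchedule_spiral (hnm : n ≤ m) :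
    (pathGraph n □ pathGraph m).IsForcingSchedule (fun v => spiralRank n m v.1 v.2)
      (fun u v => SpiralForce n m u.1 u.2 v.1 v.2) where
  exists_force := by
    rintro ⟨⟨i, hi⟩, ⟨j, hj⟩⟩ h
    simp only [spiralRank, ne_eq] at h
    split_ifs at h with h1 h2 h3 h4
    · have h' : SpiralForce n m i (j - 1) i j := by unfold SpiralForce; omega
      exact ⟨(⟨i, hi⟩, ⟨j - 1, by omega⟩), h'⟩
    · have h' : SpiralForce n m (i - 1) j i j := by unfold SpiralForce; omega
      exact ⟨(⟨i - 1, by omega⟩, ⟨j, hj⟩), h'⟩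
    · have h' : SpiralForce n m i (j + 1) i j := by unfold SpiralForce; omega
      exact ⟨(⟨i, hi⟩, ⟨j + 1, by omega⟩), h'⟩
    · have h' : SpiralForce n m (i + 1) j i j := by unfold SpiralForce; omega
      exact ⟨(⟨i + 1, by omega⟩, ⟨j, hj⟩), h'⟩
    · exact absurd rfl h
  unique := by
    rintro ⟨⟨i, hi⟩, ⟨j, hj⟩⟩ ⟨⟨k, hk⟩, ⟨l, hl⟩⟩ ⟨⟨a, ha⟩, ⟨b, hb⟩⟩ h h'
    simp only [SpiralForce, Prod.mk.injEq, Fin.mk.injEq] at *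
    omega
  adj := by
    rintro ⟨⟨i, hi⟩, ⟨j, hj⟩⟩ ⟨⟨a, ha⟩, ⟨b, hb⟩⟩ h
    simp only [SpiralForce, boxProd_pathGraph_adj] at *
    omega
  rank_lt := by
    rintro ⟨⟨i, hi⟩, ⟨j, hj⟩⟩ ⟨⟨a, ha⟩, ⟨b, hb⟩⟩ h
    simp only [SpiralForce, spiralRank] at *
    rcases h with h | h | h | h <;> split_ifs <;> omega
  rank_lt_of_adj := by
    rintro ⟨⟨i, hi⟩, ⟨j, hj⟩⟩ ⟨⟨a, ha⟩, ⟨b, hb⟩⟩ h ⟨⟨k, hk⟩, ⟨l, hl⟩⟩ hw hne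
    simp only [boxProd_pathGraph_adj, ne_eq, Prod.mk.injEq, Fin.mk.injEq] at h hw hne ⊢
    unfold SpiralForce at h
    unfold spiralRank
    have hkl : k = i - 1 ∧ l = j ∧ 0 < i ∨ k = i + 1 ∧ l = j ∨ k = i ∧ l = j - 1 ∧ 0 < j ∨
      k = i ∧ l = j + 1 := by omega
    rcases h with ⟨h1, h2, h3, rfl, rfl⟩ | ⟨h1, h2, rfl, rfl⟩ | ⟨h1, h2, h3, rfl, rfl⟩ |
      ⟨h1, h2, rfl, rfl⟩
    all_goals rcases hkl with ⟨rfl, rfl, _⟩ | ⟨rfl, rfl⟩ | ⟨rfl, rfl, _⟩ | ⟨rfl, rfl⟩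
    all_goals clear hw
    all_goals split_ifs <;> omega

/-- A cell that performs no force in the clockwise sweep is initially blue, or the last cell of its
ring. -/
theorem spiralRank_eq_zero_or_of_terminal (hnm : n ≤ m) (u : Fin n × Fin m)
    (hu : ∀ v : Fin n × Fin m, ¬ SpiralForce n m u.1 u.2 v.1 v.2) :
    spiralRank n m u.1 u.2 = 0 ∨ u.1.val = u.2.val + 1 ∧ 2 * u.2.val + 1 < n := by
  obtain ⟨⟨i, hi⟩, ⟨j, hj⟩⟩ := u
  by_contra hne
  simp only [not_or, spiralRank] at hne
  obtain ⟨h0, hne⟩ := hne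
  have right : ∀ h : j + 1 < m, ¬ SpiralForce n m i j i (j + 1) :=
    fun h => hu (⟨i, hi⟩, ⟨j + 1, h⟩)
  have left : ¬ SpiralForce n m i j i (j - 1) := hu (⟨i, hi⟩, ⟨j - 1, by omega⟩)
  have down : ∀ h : i + 1 < n, ¬ SpiralForce n m i j (i + 1) j :=
    fun h => hu (⟨i + 1, h⟩, ⟨j, hj⟩)
  have up : ¬ SpiralForce n m i j (i - 1) j := hu (⟨i - 1, by omega⟩, ⟨j, hj⟩)
  clear hu
  split_ifs at h0 with h1 h2 h3 h4
  · by_cases h : i + j + 1 < m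
    · exact right (by omega) (Or.inl (by omega))
    · exact down (by omega) (Or.inr (Or.inl (by omega)))
  · by_cases h : i + 1 + m ≤ n + j
    · exact down (by omega) (Or.inr (Or.inl (by omega)))
    · exact left (Or.inr (Or.inr (Or.inl (by omega))))
  · by_cases h : n ≤ i + j
    · exact left (Or.inr (Or.inr (Or.inl (by omega))))
    · exact up (Or.inr (Or.inr (Or.inr (by omega))))
  · exact up (Or.inr (Or.inr (Or.inr (by omega))))
  · exact h0 rfl

/-- The last cells of the rings turn blue if none of the first cells is the leak. -/
theorem IsStalled.ring_end_mem (hnm : n ≤ m) {x : Fin n × Fin m} {S : Finset (Fin n × Fin m)}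
    (hS : (pathGraph n □ pathGraph m).IsStalled x S)
    (h0 : ∀ v : Fin n × Fin m, spiralRank n m v.1 v.2 = 0 → v ∈ S)
    (hx : ¬ (x.1.val = x.2.val ∧ 2 * x.1.val + 1 ≤ n)) :
    ∀ k (hk : 2 * k + 1 < n),
      ((⟨k + 1, by omega⟩, ⟨k, by omega⟩) : Fin n × Fin m) ∈ S := by
  intro k
  induction k with
  | zero =>
    intro hk
    refine hS (⟨0, by omega⟩, ⟨0, by omega⟩) _ (h0 _ ?_) ?_ ?_ ?_
    · simp only [spiralRank]
      split_ifs <;> omega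
    · rintro rfl
      exact hx ⟨rfl, by simp only; omega⟩
    · exact (boxProd_pathGraph_adj _ _).mpr (Or.inl ⟨Or.inl rfl, rfl⟩)
    · rintro ⟨⟨a, ha⟩, ⟨b, hb⟩⟩ hw hne
      simp only [boxProd_pathGraph_adj, ne_eq, Prod.mk.injEq, Fin.mk.injEq] at hw hne
      refine h0 _ ?_
      simp only [spiralRank]
      split_ifs <;> omega
  | succ k ih =>
    intro hk
    refine hS (⟨k + 1, by omega⟩, ⟨k + 1, by omega⟩) _ (h0 _ ?_) ?_ ?_ ?_
    · simp only [spiralRank]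
      split_ifs <;> omega
    · rintro rfl
      exact hx ⟨rfl, by simp only; omega⟩
    · exact (boxProd_pathGraph_adj _ _).mpr (Or.inl ⟨Or.inl rfl, rfl⟩)
    · rintro ⟨⟨a, ha⟩, ⟨b, hb⟩⟩ hw hne
      simp only [boxProd_pathGraph_adj, ne_eq, Prod.mk.injEq, Fin.mk.injEq] at hw hne
      by_cases hab : a = k + 1 ∧ b = k
      · obtain ⟨rfl, rfl⟩ := hab
        exact ih (by omega)
      · refine h0 _ ?_
        simp only [spiralRank]
        split_ifs <;> omega

theorem card_filter_spiralRank_eq_zero_le (hnm : n ≤ m) :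
    (Finset.univ.filter fun v : Fin n × Fin m => spiralRank n m v.1 v.2 = 0).card ≤ m := by
  have key : ∀ v : Fin n × Fin m, spiralRank n m v.1 v.2 = 0 →
      v.1.val = min ((v.1.val + v.2.val) / 2) ((n - 1) / 2) ∧ v.1.val + v.2.val < m := by
    rintro ⟨⟨i, hi⟩, ⟨j, hj⟩⟩ h
    simp only [spiralRank] at h ⊢
    split_ifs at h <;> omega
  refine (Finset.card_le_card_of_injOn (t := Finset.range m) (fun v => v.1.val + v.2.val)
    ?_ ?_).trans (Finset.card_range m).le
  · intro v hv
    simp only [Finset.coe_filter, Finset.mem_univ, true_and, Set.mem_ofPred_eq] at hv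
    simpa using (key v hv).2
  · intro v hv w hw hvw
    simp only [Finset.coe_filter, Finset.mem_univ, true_and, Set.mem_ofPred_eq] at hv hw hvw
    have hv' := (key v hv).1
    have hw' := (key w hw).1
    rw [hvw, ← hw'] at hv'
    exact Prod.ext (Fin.ext hv') (Fin.ext (by omega))

theorem leakyForcingNumber_one_grid_le (hnm : n ≤ m) :
    (pathGraph n □ pathGraph m).leakyForcingNumber 1 ≤ m := by
  refine (leakyForcingNumber_le_card (isLeakyForcingSet_one_of_isStalled fun x S hBS hS => ?_)).trans
    (card_filter_spiralRank_eq_zero_le hnm)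
  have h0 : ∀ v : Fin n × Fin m, spiralRank n m v.1 v.2 = 0 → v ∈ S :=
    fun v hv => hBS (by simpa using hv)
  by_cases hx : x.1.val = x.2.val ∧ 2 * x.1.val + 1 ≤ n
  · refine (isForcingSchedule_spiral hnm).eq_univ_of_leak_idle hS h0 fun v hv => ?_
    simp only [SpiralForce] at hv
    omega
  · refine (isForcingSchedule_spiral hnm).eq_univ_of_terminal_mem hS h0 fun u hu => ?_
    rcases spiralRank_eq_zero_or_of_terminal hnm u hu with h | ⟨h1, h2⟩
    · exact h0 u h
    · convert hS.ring_end_mem hnm h0 hx u.2.val h2 using 1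
      exact Prod.ext (Fin.ext h1) rfl

end Grid

end SimpleGraph

theorem theorem4p5 (n m : ℕ) (hn : 1 ≤ n) (hnm : n ≤ m) :
    (SimpleGraph.boxProd (SimpleGraph.pathGraph n) (SimpleGraph.pathGraph m)).leakyForcingNumber 1
      ≤ min (2 * n) m :=
  le_min SimpleGraph.leakyForcingNumber_one_grid_le_two_mul
    (SimpleGraph.leakyForcingNumber_one_grid_le hnm)
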